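/- Let $C$ be an algebraically closed field of characteristic zero, let $K=C(x)$ be equipped with the derivation $D=d/dx$, and let $K[D]$ be the ring of linear differential operators over $K$ (with $Da=aD+a'$ for $a\in K$). A Puiseux series at $\xi\in C$ (resp. at $\infty$) is a series $\sum_{n\ge n_0}c_n t^{n/q}$ with $n_0\in\mathbb Z$, $q\in\{1,2,\dots\}$, $c_n\in C$, where $t=x-\xi$ (resp. $t=x^{-1}$); it is integral if it is zero or its starting exponent is nonnegative. The Puiseux series at a given point form a differential field extension of $K$, on which $K[D]$ acts. Let $L\in K[D]$ be an operator of order $r$ which at every point $\xi\in C\cup\{\infty\}$ has a basis of Puiseux series solutions, i.e. the $C$-vector space of all Puiseux series $f$ at $\xi$ with $L\cdot f=0$ has dimension $r$. For $P\in K[D]$, let $[P]_L$ be the class of $P$ in the left $K[D]$-module $K[D]/\langle L\rangle$, where $\langle L\rangle=\{QL : Q\in K[D]\}$. The class $[P]_L$ is called completely integral if for every $\xi\in C\cup\{\infty\}$ and every Puiseux series solution $f$ of $L$ at $\xi$, the series $P\cdot f$ is integral; it is called a constant if $D\cdot[P]_L=[0]_L$; it is called a pseudoconstant if it is completely integral but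 not a constant. If $K[D]/\langle L\rangle$ contains a pseudoconstant, then $L$ has at least one transcendental solution. More precisely: $L$ does not have only algebraic solutions, i.e. there is no differential field $E\supseteq K$ of finite degree over $K$ in which the solution space of $L$ has dimension $r$ over $C$; and at every point $\xi\in C\cup\{\infty\}$ there is a Puiseux series solution of $L$ that is transcendental over $K$. -/

import Mathlib

open scoped Differential Polynomial

noncomputable section

universe u

/-- The differential ring given by an additive map satisfying the Leibniz rule. -/
abbrev Differential.ofAddMonoidHom {R : Type u} [CommRing R] (d : R →+ R)
    (hd : ∀ a b : R, d (a * b) = a * d b + b * d a) : Differential R :=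
  ⟨Derivation.mk' d.toIntLinearMap hd⟩

/-! ### The differential field `K = C(x)` -/

namespace RatFunc

variable {C : Type u} [Field C]

/-- The quotient rule, as a function: `f = p / q` is sent to `(p' q - p q') / q ^ 2`. -/
def ddxFun (f : RatFunc C) : RatFunc C :=
  algebraMap C[X] (RatFunc C)
    (Polynomial.derivative f.num * f.denom - f.num * Polynomial.derivative f.denom) /
      algebraMap C[X] (RatFunc C) f.denom ^ 2

/-- The quotient rule holds for every representation of a rational function as a fraction. -/
theorem ddxFun_div (p q : C[X]) (hq : q ≠ 0) :
    ddxFun (algebraMap C[X] (RatFunc C) p / algebraMap C[X] (RatFunc C) q) =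
      algebraMap C[X] (RatFunc C)
        (Polynomial.derivative p * q - p * Polynomial.derivative q) /
          algebraMap C[X] (RatFunc C) q ^ 2 := by
  set f := algebraMap C[X] (RatFunc C) p / algebraMap C[X] (RatFunc C) q with hf
  have hd : f.denom ≠ 0 := f.denom_ne_zero
  have hq' : algebraMap C[X] (RatFunc C) q ≠ 0 := RatFunc.algebraMap_ne_zero hq
  have hd' : algebraMap C[X] (RatFunc C) f.denom ≠ 0 := RatFunc.algebraMap_ne_zero hd
  have h1 : f.num * q = p * f.denom := by
    apply RatFunc.algebraMap_injective C
    have h2 := f.num_div_denom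
    rw [hf, div_eq_div_iff (hf ▸ hd') hq', ← hf] at h2
    simpa using h2
  have h2 := congrArg Polynomial.derivative h1
  simp only [Polynomial.derivative_mul] at h2
  rw [ddxFun, div_eq_div_iff (pow_ne_zero 2 hd') (pow_ne_zero 2 hq')]
  rw [← map_pow, ← map_pow, ← map_mul, ← map_mul]
  congr 1
  linear_combination (q * f.denom) * h2 -
    (Polynomial.derivative q * f.denom + q * Polynomial.derivative f.denom) * h1

theorem exists_fraction (f : RatFunc C) : ∃ p q : C[X], q ≠ 0 ∧
    f = algebraMap C[X] (RatFunc C) p / algebraMap C[X] (RatFunc C) q :=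
  ⟨f.num, f.denom, f.denom_ne_zero, f.num_div_denom.symm⟩

theorem ddxFun_add (f g : RatFunc C) : ddxFun (f + g) = ddxFun f + ddxFun g := by
  obtain ⟨p, q, hq, rfl⟩ := exists_fraction f
  obtain ⟨r, s, hs, rfl⟩ := exists_fraction g
  have hq' : algebraMap C[X] (RatFunc C) q ≠ 0 := RatFunc.algebraMap_ne_zero hq
  have hs' : algebraMap C[X] (RatFunc C) s ≠ 0 := RatFunc.algebraMap_ne_zero hs
  rw [div_add_div _ _ hq' hs', ← map_mul, ← map_mul, ← map_mul, ← map_add,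
    ddxFun_div _ _ (mul_ne_zero hq hs), ddxFun_div _ _ hq, ddxFun_div _ _ hs]
  simp only [Polynomial.derivative_mul, map_mul, map_add, map_sub]
  field_simp
  ring

theorem ddxFun_mul (f g : RatFunc C) : ddxFun (f * g) = f * ddxFun g + g * ddxFun f := by
  obtain ⟨p, q, hq, rfl⟩ := exists_fraction f
  obtain ⟨r, s, hs, rfl⟩ := exists_fraction g
  have hq' : algebraMap C[X] (RatFunc C) q ≠ 0 := RatFunc.algebraMap_ne_zero hq
  have hs' : algebraMap C[X] (RatFunc C) s ≠ 0 := RatFunc.algebraMap_ne_zero hs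
  rw [div_mul_div_comm, ← map_mul, ← map_mul,
    ddxFun_div _ _ (mul_ne_zero hq hs), ddxFun_div _ _ hq, ddxFun_div _ _ hs]
  simp only [Polynomial.derivative_mul, map_mul, map_add, map_sub]
  field_simp
  ring

theorem ddxFun_C (c : C) : ddxFun (algebraMap C (RatFunc C) c) = 0 := by
  have h : algebraMap C (RatFunc C) c =
      algebraMap C[X] (RatFunc C) (Polynomial.C c) / algebraMap C[X] (RatFunc C) 1 := by
    rw [map_one, div_one]; rfl
  rw [h, ddxFun_div _ _ one_ne_zero]
  simp

/-- The usual derivation `d/dx` of the field `C(x)`. -/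
def ddx : Derivation C (RatFunc C) (RatFunc C) :=
  Derivation.mk'
    { toFun := ddxFun
      map_add' := ddxFun_add
      map_smul' := fun c f => by
        simp only [Algebra.smul_def, ddxFun_mul, ddxFun_C, RingHom.id_apply, mul_zero, add_zero] }
    (fun f g => by simpa using ddxFun_mul f g)

instance : Differential (RatFunc C) :=
  Differential.ofAddMonoidHom ddx.toLinearMap.toAddMonoidHom ddx.leibniz

theorem deriv_eq_ddx (f : RatFunc C) : f′ = ddx f := rfl

theorem deriv_algebraMap_const (c : C) : (algebraMap C (RatFunc C) c)′ = 0 := ddxFun_C c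

theorem deriv_X : (RatFunc.X : RatFunc C)′ = 1 := by
  have h : (RatFunc.X : RatFunc C) =
      algebraMap C[X] (RatFunc C) Polynomial.X / algebraMap C[X] (RatFunc C) 1 := by
    rw [map_one, div_one, RatFunc.algebraMap_X]
  change ddxFun (RatFunc.X : RatFunc C) = 1
  rw [h, ddxFun_div _ _ one_ne_zero]
  simp

end RatFunc

/-! ### Linear differential operators with coefficients in a differential field -/

/-- The ring `K[D]` of linear differential operators `p₀ + p₁ D + ⋯ + p_r D ^ r`, the coefficients
written on the left. The underlying additive group is that of the polynomials over `K` (with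
`D` as the variable); the multiplication, defined below, is *not* that of polynomials. -/
def DiffOp (K : Type u) [Field K] [Differential K] : Type u := K[X]

namespace DiffOp

variable {K : Type u} [Field K] [Differential K]

instance : AddCommGroup (DiffOp K) := inferInstanceAs (AddCommGroup K[X])

/-- The operator with the given list of coefficients. -/
def ofPoly : K[X] ≃+ DiffOp K := AddEquiv.refl _

/-- The coefficient of `D ^ i`. -/
def coeff (P : DiffOp K) (i : ℕ) : K := Polynomial.coeff (ofPoly.symm P) i

/-- The order of an operator (with the value `0` for the zero operator). -/
def order (P : DiffOp K) : ℕ := Polynomial.natDegree (ofPoly.symm P)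

/-- The derivation `D`, viewed as an operator. -/
def D : DiffOp K := ofPoly Polynomial.X

/-- A function `a ∈ K`, viewed as the operator of multiplication by `a`. -/
def const (a : K) : DiffOp K := ofPoly (Polynomial.C a)

section evalAt

variable {M : Type*} [AddCommGroup M] [Module K M]

/-- For an additive endomorphism `δ` of a `K`-vector space `M`, the additive endomorphism
`p₀ + p₁ δ + ⋯ + p_r δ ^ r` of `M` (see `evalAt_apply`). -/
def evalAt (δ : AddMonoid.End M) (P : K[X]) : AddMonoid.End M :=
  Polynomial.eval₂ (Module.toAddMonoidEnd K M) δ P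

theorem evalAt_apply (δ : AddMonoid.End M) (P : K[X]) (m : M) :
    evalAt δ P m = ∑ i ∈ Finset.range (P.natDegree + 1), P.coeff i • δ^[i] m := by
  rw [evalAt, Polynomial.eval₂_eq_sum_range]
  refine (AddMonoidHom.finsetSum_apply _ _ _).trans ?_
  refine Finset.sum_congr rfl fun i _ => ?_
  rw [← AddMonoid.End.coe_pow]
  rfl

theorem evalAt_add (δ : AddMonoid.End M) (P Q : K[X]) :
    evalAt δ (P + Q) = evalAt δ P + evalAt δ Q := Polynomial.eval₂_add _ _

theorem add_end_apply (φ ψ : AddMonoid.End M) (m : M) : (φ + ψ) m = φ m + ψ m := rfl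

theorem evalAt_monomial (δ : AddMonoid.End M) (n : ℕ) (a : K) :
    evalAt δ (Polynomial.monomial n a) = Module.toAddMonoidEnd K M a * δ ^ n :=
  Polynomial.eval₂_monomial _ _

end evalAt

/-- Left multiplication by `D` on operators: since `D a = a D + a'`, the operator
`∑ pᵢ D ^ i` is sent to `∑ pᵢ' D ^ i + ∑ pᵢ D ^ (i + 1)`. -/
def leftD : AddMonoid.End K[X] := AddMonoidHom.mk'
  (fun P => P.sum fun i a => Polynomial.monomial i (a′) + Polynomial.monomial (i + 1) a)
  (fun P Q => Polynomial.sum_add_index P Q _ (by simp)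
    (by intro i a b; simp only [map_add]; abel))

theorem leftD_monomial (n : ℕ) (a : K) : leftD (Polynomial.monomial n a) =
    Polynomial.monomial n (a′) + Polynomial.monomial (n + 1) a :=
  Polynomial.sum_monomial_index (S := K[X]) a
    (fun i a => Polynomial.monomial i (a′) + Polynomial.monomial (i + 1) a) (by simp)

theorem leftD_smul (a : K) (P : K[X]) : leftD (a • P) = a′ • P + a • leftD P := by
  induction P using Polynomial.induction_on' with
  | add P Q hP hQ => rw [smul_add, map_add, hP, hQ, map_add, smul_add, smul_add]; abel
  | monomial n b =>
    simp only [Polynomial.smul_monomial, leftD_monomial, smul_eq_mul, Derivation.leibniz,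
      map_add, smul_add, mul_comm]
    abel

theorem leftD_pow_one (n : ℕ) : (leftD ^ n) (1 : K[X]) = Polynomial.monomial n 1 := by
  induction n with
  | zero => rfl
  | succ n ih =>
    rw [pow_succ', AddMonoid.End.coe_mul, Function.comp_apply, ih, leftD_monomial]
    simp

/-- The product of operators: `(∑ pᵢ D ^ i) Q = ∑ pᵢ (D ^ i Q)`. -/
instance : Mul (DiffOp K) := ⟨fun P Q => ofPoly (evalAt leftD (ofPoly.symm P) (ofPoly.symm Q))⟩

instance : One (DiffOp K) := ⟨const 1⟩

section evalAt

variable {M : Type*} [AddCommGroup M] [Module K M]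

theorem evalAt_smul (δ : AddMonoid.End M) (a : K) (P : K[X]) :
    evalAt δ (a • P) = Module.toAddMonoidEnd K M a * evalAt δ P := by
  induction P using Polynomial.induction_on' with
  | add P Q hP hQ => rw [smul_add, evalAt_add, hP, hQ, evalAt_add, mul_add]
  | monomial n b =>
    rw [Polynomial.smul_monomial, evalAt_monomial, evalAt_monomial, smul_eq_mul, map_mul, mul_assoc]

theorem evalAt_leftD (δ : AddMonoid.End M) (hδ : ∀ (a : K) (m : M), δ (a • m) = a′ • m + a • δ m)
    (P : K[X]) : evalAt δ (leftD P) = δ * evalAt δ P := by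
  induction P using Polynomial.induction_on' with
  | add P Q hP hQ => rw [map_add, evalAt_add, hP, hQ, evalAt_add, mul_add]
  | monomial n b =>
    rw [leftD_monomial, evalAt_add, evalAt_monomial, evalAt_monomial, evalAt_monomial, pow_succ']
    ext m
    exact (hδ b ((δ ^ n) m)).symm

theorem evalAt_mul (δ : AddMonoid.End M) (hδ : ∀ (a : K) (m : M), δ (a • m) = a′ • m + a • δ m)
    (P Q : DiffOp K) : evalAt δ (ofPoly.symm (P * Q)) =
      evalAt δ (ofPoly.symm P) * evalAt δ (ofPoly.symm Q) := by
  change evalAt δ (evalAt leftD (ofPoly.symm P) (ofPoly.symm Q)) = _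
  generalize (ofPoly.symm Q : K[X]) = Q'
  generalize (ofPoly.symm P : K[X]) = P'
  induction P' using Polynomial.induction_on' with
  | add P R hP hR => rw [evalAt_add, add_end_apply, evalAt_add, hP, hR, evalAt_add, add_mul]
  | monomial n b =>
    have h : ∀ k : ℕ, evalAt δ ((leftD ^ k) Q') = δ ^ k * evalAt δ Q' := by
      intro k
      induction k with
      | zero => rw [pow_zero, pow_zero, one_mul]; rfl
      | succ k ih => rw [pow_succ', pow_succ', AddMonoid.End.coe_mul, Function.comp_apply, evalAt_leftD δ hδ, ih,
          mul_assoc]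
    rw [evalAt_monomial, evalAt_monomial, mul_assoc, ← h, ← evalAt_smul]
    rfl

theorem evalAt_one (δ : AddMonoid.End M) : evalAt δ (ofPoly.symm (1 : DiffOp K)) = 1 := by
  change evalAt δ (Polynomial.C 1) = 1
  rw [← Polynomial.monomial_zero_left, evalAt_monomial, map_one, pow_zero, one_mul]

end evalAt

theorem evalAt_leftD_one (P : K[X]) : evalAt leftD P (1 : K[X]) = P := by
  induction P using Polynomial.induction_on' with
  | add P Q hP hQ => rw [evalAt_add, add_end_apply, hP, hQ]
  | monomial n b =>
    rw [evalAt_monomial, AddMonoid.End.coe_mul, Function.comp_apply, leftD_pow_one]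
    exact (Polynomial.smul_monomial b n (1 : K)).trans (by rw [smul_eq_mul, mul_one])

theorem evalAt_leftD_mul (P Q : DiffOp K) :
    evalAt (leftD : AddMonoid.End K[X]) (ofPoly.symm (P * Q)) =
      evalAt leftD (ofPoly.symm P) * evalAt leftD (ofPoly.symm Q) :=
  evalAt_mul (M := K[X]) leftD (fun a m => leftD_smul a m) P Q

instance : Ring (DiffOp K) where
  __ := (inferInstance : AddCommGroup (DiffOp K))
  __ := (inferInstance : Mul (DiffOp K))
  __ := (inferInstance : One (DiffOp K))
  left_distrib P Q R := map_add (evalAt leftD (ofPoly.symm P)) (ofPoly.symm Q) (ofPoly.symm R)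
  right_distrib P Q R :=
    congrArg (fun φ : AddMonoid.End K[X] => φ (ofPoly.symm R))
      (evalAt_add leftD (ofPoly.symm P) (ofPoly.symm Q))
  zero_mul Q :=
    congrArg (fun φ : AddMonoid.End K[X] => φ (ofPoly.symm Q)) (Polynomial.eval₂_zero _ _)
  mul_zero P := map_zero (evalAt leftD (ofPoly.symm P))
  mul_assoc P Q R :=
    congrArg (fun φ : AddMonoid.End K[X] => φ (ofPoly.symm R)) (evalAt_leftD_mul P Q)
  one_mul P := congrArg (fun φ : AddMonoid.End K[X] => φ (ofPoly.symm P)) (evalAt_one leftD)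
  mul_one P := evalAt_leftD_one (ofPoly.symm P)

/-- The commutation rule `D a = a D + a'`. -/
theorem D_mul_const (a : K) : D * const a = const a * D + const (a′) := by
  change evalAt leftD Polynomial.X (Polynomial.C a) =
    evalAt leftD (Polynomial.C a) (Polynomial.X : K[X]) + Polynomial.C (a′)
  have hX : (Polynomial.X : K[X]) = Polynomial.monomial 1 1 := rfl
  rw [hX, ← Polynomial.monomial_zero_left, ← Polynomial.monomial_zero_left, evalAt_monomial,
    evalAt_monomial, map_one, one_mul, pow_one, leftD_monomial, pow_zero, mul_one, add_comm]
  congr 1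
  exact ((Polynomial.smul_monomial a 1 (1 : K)).trans (by rw [smul_eq_mul, mul_one])).symm

section action

variable {F : Type*} [Field F] [Algebra K F] [Differential F] [DifferentialAlgebra K F]

/-- The derivation of `F` as an additive endomorphism. -/
def derivEnd (F : Type*) [Field F] [Differential F] : AddMonoid.End F :=
  (Differential.deriv : Derivation ℤ F F).toLinearMap.toAddMonoidHom

theorem derivEnd_smul (a : K) (y : F) :
    derivEnd F (a • y) = a′ • y + a • derivEnd F y := by
  change (a • y)′ = a′ • y + a • (y′)
  rw [Algebra.smul_def, Algebra.smul_def, Algebra.smul_def, Derivation.leibniz, deriv_algebraMap,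
    smul_eq_mul, smul_eq_mul]
  ring

/-- The action `(p₀ + p₁ D + ⋯ + p_r D ^ r) • y = p₀ y + p₁ y' + ⋯ + p_r y⁽ʳ⁾` of `K[D]` on a
differential field `F` extending `K` (see `smul_eq_sum`), which makes `F` a left
`K[D]`-module. -/
instance : Module (DiffOp K) F where
  smul P y := evalAt (derivEnd F) (ofPoly.symm P) y
  one_smul y := congrArg (fun φ : AddMonoid.End F => φ y) (evalAt_one (K := K) (derivEnd F))
  mul_smul P Q y := congrArg (fun φ : AddMonoid.End F => φ y)
    (evalAt_mul (M := F) (derivEnd F) (fun a m => derivEnd_smul a m) P Q)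
  smul_zero P := map_zero (evalAt (derivEnd F) (ofPoly.symm P))
  smul_add P y z := map_add (evalAt (derivEnd F) (ofPoly.symm P)) y z
  add_smul P Q y := congrArg (fun φ : AddMonoid.End F => φ y)
    (evalAt_add (derivEnd F) (ofPoly.symm P) (ofPoly.symm Q))
  zero_smul y := congrArg (fun φ : AddMonoid.End F => φ y)
    (Polynomial.eval₂_zero (Module.toAddMonoidEnd K F) (derivEnd F))

theorem smul_eq_sum (P : DiffOp K) (y : F) :
    P • y = ∑ i ∈ Finset.range (P.order + 1),
      algebraMap K F (P.coeff i) * (fun z : F => z′)^[i] y := by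
  refine (evalAt_apply (derivEnd F) (ofPoly.symm P) y).trans ?_
  exact Finset.sum_congr rfl fun i _ => Algebra.smul_def _ _

end action

end DiffOp

/-! ### Puiseux series at the points of the projective line -/

/-- The field of Puiseux series in one variable `t` over `C`: formal series `∑ a_s t ^ s` with
rational exponents, whose support is well-ordered and contained in `(1/q)ℤ` for some positive
integer `q`; equivalently, the union over `q` of the fields `C((t ^ (1/q)))`. -/
def puiseuxField (C : Type u) [Field C] : Subfield (HahnSeries ℚ C) where
  carrier := {f | ∃ q : ℕ, 0 < q ∧ ∀ s ∈ f.support, ∃ n : ℤ, s = (n : ℚ) / q}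
  mul_mem' := by
    rintro f g ⟨q, hq, hf⟩ ⟨r, hr, hg⟩
    refine ⟨q * r, Nat.mul_pos hq hr, fun s hs => ?_⟩
    obtain ⟨a, ha, b, hb, rfl⟩ := Set.mem_add.1 (HahnSeries.support_mul_subset hs)
    obtain ⟨m, rfl⟩ := hf a ha
    obtain ⟨n, rfl⟩ := hg b hb
    refine ⟨m * r + n * q, ?_⟩
    have h1 : (q : ℚ) ≠ 0 := by positivity
    have h2 : (r : ℚ) ≠ 0 := by positivity
    push_cast
    field_simp
  add_mem' := by
    rintro f g ⟨q, hq, hf⟩ ⟨r, hr, hg⟩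
    refine ⟨q * r, Nat.mul_pos hq hr, fun s hs => ?_⟩
    have h1 : (q : ℚ) ≠ 0 := by positivity
    have h2 : (r : ℚ) ≠ 0 := by positivity
    rcases HahnSeries.support_add_subset _ _ hs with h | h
    · obtain ⟨m, rfl⟩ := hf s h
      refine ⟨m * r, ?_⟩
      push_cast
      field_simp
    · obtain ⟨m, rfl⟩ := hg s h
      refine ⟨m * q, ?_⟩
      push_cast
      field_simp
  zero_mem' := ⟨1, one_pos, fun s hs => absurd rfl hs⟩
  one_mem' := by
    refine ⟨1, one_pos, fun s hs => ⟨0, ?_⟩⟩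
    by_contra h
    exact hs (HahnSeries.coeff_single_of_ne (by simpa using h))
  neg_mem' := by
    rintro f ⟨q, hq, hf⟩
    exact ⟨q, hq, fun s hs => hf s (by simpa using hs)⟩
  inv_mem' := by
    rintro f ⟨q, hq, hf⟩
    refine ⟨q, hq, ?_⟩
    have hq' : (0 : ℚ) < q := by exact_mod_cast hq
    rcases eq_or_ne f 0 with rfl | hf0
    · intro s hs
      simp at hs
    -- the part of `f⁻¹` with exponents in `(1/q)ℤ` is also an inverse of `f`
    classical
    let H : Set ℚ := {s | ∃ n : ℤ, s = (n : ℚ) / q}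
    let g : HahnSeries ℚ C :=
      { coeff := fun s => if s ∈ H then f⁻¹.coeff s else 0
        isPWO_support' := f⁻¹.isPWO_support.mono (by
          intro s hs
          by_cases h : s ∈ H
          · simpa [h] using hs
          · simp [h] at hs) }
    have hg : g.support ⊆ f⁻¹.support := by
      intro s hs
      by_cases h : s ∈ H
      · simpa [g, h] using hs
      · simp [g, h] at hs
    have hfg : f * g = 1 := by
      have hff : f * f⁻¹ = 1 := mul_inv_cancel₀ hf0
      ext s
      rw [← hff, HahnSeries.coeff_mul_right' f⁻¹.isPWO_support hg, hff]
      by_cases hs : s ∈ H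
      · rw [← hff, HahnSeries.coeff_mul]
        refine Finset.sum_congr rfl fun ij hij => ?_
        obtain ⟨h1, -, h3⟩ := Finset.mem_antidiagonal.1 hij
        obtain ⟨m, hm⟩ := hf _ h1
        obtain ⟨n, hn⟩ := hs
        have : ij.2 ∈ H := ⟨n - m, by push_cast; rw [sub_div, ← hn, ← hm]; linarith⟩
        simp [g, this]
      · have hs0 : s ≠ 0 := by
          rintro rfl
          exact hs ⟨0, by simp⟩
        rw [HahnSeries.coeff_one, if_neg hs0]
        refine Finset.sum_eq_zero fun ij hij => ?_
        obtain ⟨h1, -, h3⟩ := Finset.mem_antidiagonal.1 hij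
        obtain ⟨m, hm⟩ := hf _ h1
        have : ij.2 ∉ H := by
          rintro ⟨n, hn⟩
          exact hs ⟨m + n, by push_cast; rw [add_div, ← hn, ← hm]; linarith⟩
        simp [g, this]
    have hinv : f⁻¹ = g := inv_eq_of_mul_eq_one_right hfg
    intro s hs
    rw [hinv] at hs
    by_contra h
    exact hs (if_neg h)


namespace Puiseux

variable {C : Type u} [Field C]

/-- The monomial `c t ^ n`. -/
def mono (n : ℤ) (c : C) : puiseuxField C :=
  ⟨HahnSeries.single (n : ℚ) c, 1, one_pos, fun s hs => ⟨n, by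
    by_contra h
    exact hs (HahnSeries.coeff_single_of_ne (by simpa using h))⟩⟩

theorem mono_mul_mono (m n : ℤ) (a b : C) : mono m a * mono n b = mono (m + n) (a * b) := by
  apply Subtype.ext
  change HahnSeries.single (m : ℚ) a * HahnSeries.single (n : ℚ) b = HahnSeries.single _ _
  rw [HahnSeries.single_mul_single]
  push_cast
  rfl

/-- The constant series. -/
def const : C →+* puiseuxField C :=
  (HahnSeries.C : C →+* HahnSeries ℚ C).codRestrict (puiseuxField C) fun c => by
    have h := (mono 0 c).2
    change HahnSeries.single ((0 : ℤ) : ℚ) c ∈ puiseuxField C at h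
    rwa [Int.cast_zero] at h

theorem const_eq_mono (c : C) : const c = mono 0 c := by
  apply Subtype.ext
  change HahnSeries.single (0 : ℚ) c = HahnSeries.single ((0 : ℤ) : ℚ) c
  rw [Int.cast_zero]

variable [CharZero C]

/-- The derivation `t d/dt`, that is, `∑ a_s t ^ s ↦ ∑ s a_s t ^ s`, on all Hahn series. -/
def hahnEuler (f : HahnSeries ℚ C) : HahnSeries ℚ C where
  coeff s := (s : C) * f.coeff s
  isPWO_support' := f.isPWO_support.mono (by
    intro s hs h
    exact hs (by simp only [h, mul_zero]))

theorem support_hahnEuler (f : HahnSeries ℚ C) : (hahnEuler f).support ⊆ f.support := by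
  intro s hs h
  exact hs (by simp only [hahnEuler, h, mul_zero])

theorem hahnEuler_mul (f g : HahnSeries ℚ C) :
    hahnEuler (f * g) = f * hahnEuler g + g * hahnEuler f := by
  rw [mul_comm g]
  ext s
  rw [HahnSeries.coeff_add, HahnSeries.coeff_mul_right' g.isPWO_support (support_hahnEuler g),
    HahnSeries.coeff_mul_left' f.isPWO_support (support_hahnEuler f), ← Finset.sum_add_distrib]
  change (s : C) * (f * g).coeff s = _
  rw [HahnSeries.coeff_mul, Finset.mul_sum]
  refine Finset.sum_congr rfl fun ij hij => ?_
  obtain ⟨-, -, h3⟩ := Finset.mem_antidiagonal.1 hij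
  have h4 : (s : C) = (ij.1 : C) + (ij.2 : C) := by rw [← h3]; push_cast; rfl
  change _ = f.coeff ij.1 * ((ij.2 : C) * g.coeff ij.2) + (ij.1 : C) * f.coeff ij.1 * g.coeff ij.2
  rw [h4]
  ring

/-- The derivation `t d/dt` on Puiseux series. -/
def euler : puiseuxField C →+ puiseuxField C := AddMonoidHom.mk'
  (fun f => ⟨hahnEuler f.1, by
    obtain ⟨q, hq, hf⟩ := f.2
    exact ⟨q, hq, fun s hs => hf s (support_hahnEuler _ hs)⟩⟩)
  (fun f g => by
    apply Subtype.ext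
    ext s
    exact mul_add _ _ _)

theorem euler_mul (f g : puiseuxField C) : euler (f * g) = f * euler g + g * euler f :=
  Subtype.ext (hahnEuler_mul f.1 g.1)

theorem euler_mono (n : ℤ) (c : C) : euler (mono n c) = mono n (n * c) := by
  apply Subtype.ext
  ext s
  change (s : C) * (HahnSeries.single (n : ℚ) c).coeff s =
    (HahnSeries.single (n : ℚ) ((n : C) * c)).coeff s
  rcases eq_or_ne s n with rfl | h
  · simp
  · simp [HahnSeries.coeff_single_of_ne h]

end Puiseux

/-- The field of Puiseux series at `ξ ∈ C ∪ {∞}`. Its elements are series in the local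
parameter `t`, where `t = x - ξ` if `ξ ∈ C` and `t = x⁻¹` if `ξ = ∞`; the point `ξ` determines
how `C(x)` is embedded and how series are differentiated with respect to `x`. -/
def PuiseuxAt (C : Type u) [Field C] (_ξ : OnePoint C) : Type u := puiseuxField C

namespace PuiseuxAt

variable {C : Type u} [Field C]

instance (ξ : OnePoint C) : Field (PuiseuxAt C ξ) := inferInstanceAs (Field (puiseuxField C))

/-- The underlying series in the local parameter. -/
def toHahn {ξ : OnePoint C} (f : PuiseuxAt C ξ) : HahnSeries ℚ C :=
  Subtype.val (p := fun g => g ∈ puiseuxField C) f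

/-- A Puiseux series is integral if it is zero or its starting exponent is nonnegative. -/
def IsIntegral {ξ : OnePoint C} (f : PuiseuxAt C ξ) : Prop :=
  f.toHahn = 0 ∨ 0 ≤ f.toHahn.order

/-- The expansion of the function `x` at a point: `ξ + t` at `ξ ∈ C`, and `t⁻¹` at infinity. -/
def x : (ξ : OnePoint C) → PuiseuxAt C ξ
  | none => Puiseux.mono (-1) 1
  | some ξ => (Puiseux.const ξ + Puiseux.mono 1 1 : puiseuxField C)

/-- The derivative `dt/dx` of the local parameter, divided by `t`:
it is `t⁻¹` at `ξ ∈ C`, and `-t` at infinity. -/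
def dlogParam : (ξ : OnePoint C) → PuiseuxAt C ξ
  | none => Puiseux.mono 1 (-1)
  | some _ => Puiseux.mono (-1) 1

instance (ξ : OnePoint C) : Algebra C (PuiseuxAt C ξ) :=
  RingHom.toAlgebra (S := PuiseuxAt C ξ) Puiseux.const

variable [CharZero C]

/-- The derivation `t d/dt`. -/
def tddt (ξ : OnePoint C) : PuiseuxAt C ξ →+ PuiseuxAt C ξ := Puiseux.euler (C := C)

theorem tddt_mul {ξ : OnePoint C} (f g : PuiseuxAt C ξ) :
    tddt ξ (f * g) = f * tddt ξ g + g * tddt ξ f := Puiseux.euler_mul (C := C) f g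

theorem tddt_const {ξ : OnePoint C} (c : C) : tddt ξ (algebraMap C (PuiseuxAt C ξ) c) = 0 := by
  change Puiseux.euler (Puiseux.const c) = 0
  rw [Puiseux.const_eq_mono, Puiseux.euler_mono]
  apply Subtype.ext
  change HahnSeries.single _ _ = (0 : HahnSeries ℚ C)
  simp

/-- The derivation `d/dx = (dt/dx) d/dt` on Puiseux series: at `ξ ∈ C` it sends `t ^ s` to
`s t ^ (s - 1)`, and at infinity it sends `t ^ s` to `-s t ^ (s + 1)`. -/
def ddx (ξ : OnePoint C) : Derivation C (PuiseuxAt C ξ) (PuiseuxAt C ξ) :=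
  Derivation.mk'
    { toFun := fun f => dlogParam ξ * tddt ξ f
      map_add' := fun f g => by rw [map_add, mul_add]
      map_smul' := fun c f => by
        rw [Algebra.smul_def, Algebra.smul_def, tddt_mul, tddt_const, RingHom.id_apply]
        ring }
    (fun f g => by
      change dlogParam ξ * tddt ξ (f * g) =
        f * (dlogParam ξ * tddt ξ g) + g * (dlogParam ξ * tddt ξ f)
      rw [tddt_mul]
      ring)

theorem ddx_apply {ξ : OnePoint C} (f : PuiseuxAt C ξ) : ddx ξ f = dlogParam ξ * tddt ξ f := rfl

theorem ddx_x (ξ : OnePoint C) : ddx ξ (x ξ) = 1 := by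
  have h1 : Puiseux.mono 0 (1 : C) = 1 := by rw [← Puiseux.const_eq_mono, map_one]
  rw [ddx_apply]
  cases ξ with
  | infty =>
    change Puiseux.mono 1 (-1) * Puiseux.euler (Puiseux.mono (-1) 1) = (1 : puiseuxField C)
    rw [Puiseux.euler_mono]
    refine (Puiseux.mono_mul_mono _ _ _ _).trans (Eq.trans ?_ h1)
    simp
  | coe ξ =>
    have h2 := tddt_const (ξ := ((ξ : C) : OnePoint C)) ξ
    change Puiseux.euler (Puiseux.const ξ) = 0 at h2
    change Puiseux.mono (-1) 1 * Puiseux.euler (Puiseux.const ξ + Puiseux.mono 1 1) =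
      (1 : puiseuxField C)
    rw [map_add, h2, zero_add, Puiseux.euler_mono]
    refine (Puiseux.mono_mul_mono _ _ _ _).trans (Eq.trans ?_ h1)
    simp

instance (ξ : OnePoint C) : Differential (PuiseuxAt C ξ) :=
  Differential.ofAddMonoidHom (ddx ξ).toLinearMap.toAddMonoidHom (ddx ξ).leibniz

theorem aeval_x_injective (ξ : OnePoint C) :
    Function.Injective (Polynomial.aeval (R := C) (x ξ)) := by
  rw [injective_iff_map_eq_zero]
  suffices h : ∀ (n : ℕ) (p : C[X]), p.natDegree = n → Polynomial.aeval (x ξ) p = 0 → p = 0 from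
    fun p => h _ p rfl
  intro n
  induction n with
  | zero =>
    intro p hp h
    rw [Polynomial.eq_C_of_natDegree_eq_zero hp] at h ⊢
    rw [Polynomial.aeval_C, map_eq_zero] at h
    rw [h, map_zero]
  | succ n ih =>
    intro p hp h
    have h1 : Polynomial.aeval (x ξ) (Polynomial.derivative p) = 0 := by
      have h2 := congrArg (ddx ξ) h
      rwa [Derivation.map_aeval, ddx_x, map_zero, smul_eq_mul, mul_one] at h2
    have h3 := ih _ (by rw [Polynomial.natDegree_derivative, hp]; rfl) h1
    have h4 := Polynomial.derivative_eq_zero.1 h3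
    omega

/-- The embedding of `C(x)` into the field of Puiseux series at `ξ`, by expansion at `ξ`. -/
def expand (ξ : OnePoint C) : RatFunc C →+* PuiseuxAt C ξ :=
  RatFunc.liftRingHom (Polynomial.aeval (R := C) (x ξ)).toRingHom
    (nonZeroDivisors_le_comap_nonZeroDivisors_of_injective _ (aeval_x_injective ξ))

theorem expand_div (ξ : OnePoint C) (p q : C[X]) :
    expand ξ (algebraMap C[X] (RatFunc C) p / algebraMap C[X] (RatFunc C) q) =
      Polynomial.aeval (x ξ) p / Polynomial.aeval (x ξ) q :=
  RatFunc.liftRingHom_apply_div _ _ _ _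

theorem expand_poly (ξ : OnePoint C) (p : C[X]) :
    expand ξ (algebraMap C[X] (RatFunc C) p) = Polynomial.aeval (x ξ) p := by
  simpa using expand_div ξ p 1

theorem expand_X (ξ : OnePoint C) : expand ξ RatFunc.X = x ξ := by
  rw [← RatFunc.algebraMap_X, expand_poly, Polynomial.aeval_X]

instance (ξ : OnePoint C) : Algebra (RatFunc C) (PuiseuxAt C ξ) := (expand ξ).toAlgebra

instance (ξ : OnePoint C) : IsScalarTower C (RatFunc C) (PuiseuxAt C ξ) :=
  IsScalarTower.of_algebraMap_eq fun c => by
    change _ = expand ξ (algebraMap C[X] (RatFunc C) (Polynomial.C c))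
    rw [expand_poly, Polynomial.aeval_C]

instance (ξ : OnePoint C) : DifferentialAlgebra (RatFunc C) (PuiseuxAt C ξ) where
  deriv_algebraMap f := by
    change ddx ξ (expand ξ f) = expand ξ (RatFunc.ddxFun f)
    obtain ⟨p, q, hq, rfl⟩ := RatFunc.exists_fraction f
    have hq' : Polynomial.aeval (x ξ) q ≠ 0 := fun h =>
      hq (aeval_x_injective ξ (by rw [h, map_zero]))
    rw [RatFunc.ddxFun_div p q hq, ← map_pow, expand_div, expand_div, Derivation.leibniz_div,
      Derivation.map_aeval, Derivation.map_aeval, ddx_x]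
    simp only [map_sub, map_mul, map_pow, smul_eq_mul, mul_one]
    field_simp

end PuiseuxAt

/-! ### Solutions, integrality, pseudoconstants -/

namespace DiffOp

variable {C : Type u} [Field C]

/-- The `C`-vector space `V(L)` of all solutions of `L ∈ C(x)[D]` in a differential
field `F` extending `C(x)`. -/
def solutionSpace (L : DiffOp (RatFunc C)) (F : Type*) [Field F] [Algebra (RatFunc C) F]
    [Algebra C F] [IsScalarTower C (RatFunc C) F] [Differential F]
    [DifferentialAlgebra (RatFunc C) F] : Submodule C F where
  carrier := {y | L • y = 0}
  zero_mem' := smul_zero L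
  add_mem' {y z} hy hz := by
    change L • (y + z) = 0
    rw [smul_add, show L • y = 0 from hy, show L • z = 0 from hz, add_zero]
  smul_mem' c y hy := by
    have hd : ∀ z : F, (c • z)′ = c • (z)′ := fun z => by
      rw [Algebra.smul_def, Algebra.smul_def, Derivation.leibniz,
        IsScalarTower.algebraMap_apply C (RatFunc C) F, deriv_algebraMap,
        RatFunc.deriv_algebraMap_const, map_zero, smul_zero, add_zero, smul_eq_mul]
    have hi : ∀ i : ℕ, (fun z : F => z′)^[i] (c • y) = c • (fun z : F => z′)^[i] y := by
      intro i
      induction i with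
      | zero => rfl
      | succ i ih => rw [Function.iterate_succ_apply', Function.iterate_succ_apply', ih]; exact hd _
    change L • (c • y) = 0
    change L • y = 0 at hy
    rw [smul_eq_sum] at hy ⊢
    simp only [hi, mul_smul_comm]
    rw [← Finset.smul_sum, hy, smul_zero]

/-- `L` has only algebraic solutions: there is a differential field `E`, of finite degree over
`C(x)`, such that the solution space of `L` in `E` has dimension `ord L` over `C`
(the field of constants of `E`, for algebraically closed `C`). -/
def HasOnlyAlgebraicSolutions (L : DiffOp (RatFunc C)) : Prop :=
  ∃ (E : Type u) (_ : Field E) (_ : Algebra (RatFunc C) E) (_ : Algebra C E)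
    (_ : IsScalarTower C (RatFunc C) E) (_ : Differential E)
    (_ : DifferentialAlgebra (RatFunc C) E),
    FiniteDimensional (RatFunc C) E ∧
      Nonempty (Module.Basis (Fin L.order) C (L.solutionSpace E))

variable [CharZero C]

/-- `L` has a basis of Puiseux series solutions at `ξ`, i.e. `ord L` Puiseux series at `ξ` which
form a `C`-basis of the space of all Puiseux series solutions at `ξ`. -/
def HasPuiseuxBasisAt (L : DiffOp (RatFunc C)) (ξ : OnePoint C) : Prop :=
  Nonempty (Module.Basis (Fin L.order) C (L.solutionSpace (PuiseuxAt C ξ)))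

/-- The left `K[D]`-module `K[D]/⟨L⟩`, where `⟨L⟩ = {P L | P ∈ K[D]}` is the left ideal
generated by `L`. -/
abbrev QuotMod {K : Type u} [Field K] [Differential K] (L : DiffOp K) : Type u :=
  DiffOp K ⧸ Ideal.span {L}

/-- For a solution `f` of `L`, the map `K[D]/⟨L⟩ → F` sending the class `[P]` to `P • f`. -/
def QuotMod.applyTo {K : Type u} [Field K] [Differential K] {L : DiffOp K} {F : Type*} [Field F]
    [Algebra K F] [Differential F] [DifferentialAlgebra K F] (f : F) (hf : L • f = 0) :
    L.QuotMod →ₗ[DiffOp K] F :=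
  Submodule.liftQ (Ideal.span {L}) (LinearMap.toSpanSingleton (DiffOp K) F f) (by
    rw [Ideal.span, Submodule.span_le, Set.singleton_subset_iff]
    exact hf)

theorem QuotMod.applyTo_mk {K : Type u} [Field K] [Differential K] {L : DiffOp K} {F : Type*}
    [Field F] [Algebra K F] [Differential F] [DifferentialAlgebra K F] (f : F) (hf : L • f = 0)
    (P : DiffOp K) : QuotMod.applyTo f hf (Submodule.Quotient.mk P : L.QuotMod) = P • f := rfl

variable {L : DiffOp (RatFunc C)}

/-- A class `[P]` is integral at `ξ` if `P • f` is integral for every Puiseux series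
solution `f` of `L` at `ξ`. -/
def QuotMod.IsIntegralAt (m : L.QuotMod) (ξ : OnePoint C) : Prop :=
  ∀ (f : PuiseuxAt C ξ) (hf : L • f = 0), (QuotMod.applyTo f hf m).IsIntegral

/-- A class is completely integral if it is integral at every point of `C ∪ {∞}`. -/
def QuotMod.IsCompletelyIntegral (m : L.QuotMod) : Prop := ∀ ξ : OnePoint C, m.IsIntegralAt ξ

/-- A class `[P]` is a constant if `D [P] = [0]`. -/
def QuotMod.IsConstant {K : Type u} [Field K] [Differential K] {L : DiffOp K} (m : L.QuotMod) : Prop :=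
  (D : DiffOp K) • m = 0

/-- A pseudoconstant is a completely integral class which is not a constant. -/
def QuotMod.IsPseudoconstant (m : L.QuotMod) : Prop := m.IsCompletelyIntegral ∧ ¬ m.IsConstant

end DiffOp

end

/-! ### Degrees and right division in $K[D]$ -/

namespace DiffOp

variable {K : Type u} [Field K] [Differential K]

/-! Suppose $[P]_L$ is completely integral and $y$ is an algebraic solution of $L$. Every conjugate
of $y$ over $C(x)$ is again a solution. At each point $\xi$ these conjugates, a priori only
algebraic over the Puiseux field, are Puiseux series: $L$ already has $r$ independent solutions
there and cannot have more (`HasPuiseuxBasisAt.exists_algebraMap_eq`). So all conjugates of $P\cdot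
y$ are integral at every $\xi$, and so are the coefficients of its minimal polynomial, which are
symmetric functions of them. These coefficients are rational functions without poles on the
projective line, hence constants (`exists_algebraMap_eq_of_mem_integers`). Thus $P\cdot y$ is
algebraic over $C$, hence in $C$, and $DP$ kills $y$ (`deriv_smul_eq_zero_of_finiteDimensional`).

If $L$ has $r$ independent algebraic solutions, all of them are killed by $DP$, and therefore by the
remainder of $DP$ on right division by $L$. That remainder has order below $r$, so it vanishes by
`card_le_order`, and $D[P]_L=0$. A pseudoconstant therefore excludes a full set of algebraic
solutions, both in a finite extension of $C(x)$ and in the Puiseux field at any one point. -/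

theorem ofPoly_symm_D_mul (P : DiffOp K) : ofPoly.symm (D * P) = leftD (ofPoly.symm P) := by
  change evalAt leftD Polynomial.X (ofPoly.symm P) = _
  rw [show (Polynomial.X : K[X]) = Polynomial.monomial 1 1 from rfl, evalAt_monomial, map_one,
    one_mul, pow_one]

theorem ofPoly_symm_const_mul (a : K) (P : DiffOp K) :
    ofPoly.symm (const a * P) = a • ofPoly.symm P := by
  change evalAt leftD (Polynomial.C a) (ofPoly.symm P) = _
  rw [← Polynomial.monomial_zero_left, evalAt_monomial, pow_zero, mul_one]
  rfl

theorem leftD_coeff_succ (P : K[X]) (i : ℕ) :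
    (leftD P).coeff (i + 1) = (P.coeff (i + 1))′ + P.coeff i := by
  induction P using Polynomial.induction_on' with
  | add P Q hP hQ =>
    rw [map_add, Polynomial.coeff_add, hP, hQ]
    simp only [Polynomial.coeff_add, map_add]
    ring
  | monomial n b =>
    rw [leftD_monomial, Polynomial.coeff_add]
    simp only [Polynomial.coeff_monomial, Nat.add_right_cancel_iff]
    split_ifs <;> simp

theorem natDegree_leftD {P : K[X]} (hP : P ≠ 0) : (leftD P).natDegree = P.natDegree + 1 := by
  apply Polynomial.natDegree_eq_of_le_of_coeff_ne_zero
  · rw [Polynomial.natDegree_le_iff_coeff_eq_zero]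
    intro N hN
    obtain ⟨N, rfl⟩ : ∃ M, N = M + 1 := ⟨N - 1, by omega⟩
    rw [leftD_coeff_succ, Polynomial.coeff_eq_zero_of_natDegree_lt (by omega),
      Polynomial.coeff_eq_zero_of_natDegree_lt (by omega), map_zero, add_zero]
  · rw [leftD_coeff_succ, Polynomial.coeff_eq_zero_of_natDegree_lt (by omega), map_zero, zero_add]
    exact Polynomial.leadingCoeff_ne_zero.2 hP

/-- The witness is $D^k$: left multiplication by $D$ moves the leading coefficient up one degree
unchanged. It supplies a multiple of $L$ of any prescribed order from `L.order` on, for division and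
for recurrences. -/
theorem exists_degree_eq_mem_span {L : DiffOp K} (hL : L ≠ 0) (k : ℕ) :
    ∃ Q : DiffOp K, Q * L ≠ 0 ∧ (Q * L).order = L.order + k := by
  induction k with
  | zero => exact ⟨1, by rwa [one_mul], by rw [one_mul]; rfl⟩
  | succ k ih =>
    obtain ⟨Q, h0, h1⟩ := ih
    have h2 : (D * Q * L).order = L.order + (k + 1) := by
      rw [mul_assoc, order, ofPoly_symm_D_mul, ← add_assoc, ← h1]
      exact natDegree_leftD h0
    refine ⟨D * Q, fun h => ?_, h2⟩
    rw [h] at h2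
    have h3 : (0 : DiffOp K).order = 0 := Polynomial.natDegree_zero
    omega

/-- Division with remainder on the right. -/
theorem exists_eq_mul_add {L : DiffOp K} (hL : L ≠ 0) (P : DiffOp K) :
    ∃ Q R : DiffOp K, P = Q * L + R ∧
      (ofPoly.symm R).degree < (ofPoly.symm L).degree := by
  -- The degree with bottom element is used because `order` does not separate $0$ from nonzero
  -- functions: for `L` of order $0$ the remainder must be zero.
  induction h : (ofPoly.symm P).degree using WellFoundedLT.induction generalizing P with
  | ind d ih =>
    subst h
    by_cases hd : (ofPoly.symm P).degree < (ofPoly.symm L).degree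
    · exact ⟨0, P, by rw [zero_mul, zero_add], hd⟩
    have hP : ofPoly.symm P ≠ 0 := by
      intro h
      rw [h, Polynomial.degree_zero, bot_lt_iff_ne_bot, not_not, Polynomial.degree_eq_bot] at hd
      exact hL hd
    obtain ⟨k, hk⟩ := Nat.exists_eq_add_of_le
      (Polynomial.natDegree_le_natDegree (not_lt.1 hd))
    obtain ⟨Q, h0, h1⟩ := exists_degree_eq_mem_span hL k
    set T : K[X] := ofPoly.symm (Q * L) with hT
    have hT0 : T ≠ 0 := h0
    have hTd : T.natDegree = (ofPoly.symm P).natDegree := h1.trans hk.symm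
    -- Chosen so that $aT$ and $P$ have the same leading term.
    set a : K := (ofPoly.symm P).leadingCoeff / T.leadingCoeff with ha
    have ha0 : a ≠ 0 := div_ne_zero (Polynomial.leadingCoeff_ne_zero.2 hP)
      (Polynomial.leadingCoeff_ne_zero.2 hT0)
    have h3 : ofPoly.symm (P - const a * (Q * L)) = ofPoly.symm P - a • T := by
      rw [map_sub, ofPoly_symm_const_mul]
    have h4 : (ofPoly.symm (P - const a * (Q * L))).degree < (ofPoly.symm P).degree := by
      rw [h3]
      refine Polynomial.degree_sub_lt_left ?_ hP ?_
      · rw [Polynomial.smul_eq_C_mul, Polynomial.degree_C_mul ha0]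
        rw [Polynomial.degree_eq_natDegree hP, Polynomial.degree_eq_natDegree hT0, hTd]
      · rw [Polynomial.smul_eq_C_mul, Polynomial.leadingCoeff_mul, Polynomial.leadingCoeff_C, ha,
          div_mul_cancel₀ _ (Polynomial.leadingCoeff_ne_zero.2 hT0)]
    obtain ⟨Q', R, h5, h6⟩ := ih _ h4 _ rfl
    exact ⟨const a * Q + Q', R, by rw [add_mul, add_assoc, ← h5, mul_assoc]; abel, h6⟩

/-! ### Linear independence of jets and the bound on the number of solutions -/

section jets

variable {C F : Type*} [Field C] [Field F] [Algebra C F] [Differential F]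

/-- The sequence of all derivatives of `y`. -/
def jet (y : F) : ℕ → F := fun i => (fun z : F => z′)^[i] y

theorem jet_succ (y : F) (i : ℕ) : jet y (i + 1) = (jet y i)′ :=
  Function.iterate_succ_apply' _ _ _

/-- The Wronskian argument, with infinite jets instead of a determinant. Normalise one coefficient
of an $F$-linear relation to $1$ and differentiate: this leaves a shorter relation among the
derivatives of the coefficients. By induction these derivatives vanish, so the coefficients are
constants, and the original relation is one over $C$. -/
theorem linearIndependent_jet (hF : ∀ y : F, y′ = 0 → ∃ c : C, algebraMap C F c = y)
    {ι : Type*} {f : ι → F} (hf : LinearIndependent C f) :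
    LinearIndependent F fun i => jet (f i) := by
  classical
  rw [linearIndependent_iff']
  intro s
  induction s using Finset.induction_on with
  | empty => simp
  | insert i₀ s hi₀ ih =>
    intro a ha
    have key : a i₀ = 0 := by
      by_contra h0
      set b : ι → F := fun i => a i / a i₀ with hb
      have hb0 : b i₀ = 1 := div_self h0
      have h1 : ∀ j, ∑ i ∈ insert i₀ s, b i * jet (f i) j = 0 := by
        intro j
        have h := congrFun ha j
        simp only [Finset.sum_apply, Pi.smul_apply, smul_eq_mul, Pi.zero_apply] at h
        simp only [hb, div_mul_eq_mul_div]
        rw [← Finset.sum_div, h, zero_div]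
      -- The derivative of relation $j$ is this sum plus relation $j+1$, which vanishes; the term at
      -- `i₀` drops out because `b i₀ = 1`.
      have h2 : ∀ j, ∑ i ∈ s, (b i)′ * jet (f i) j = 0 := by
        intro j
        have h := congrArg (fun z : F => z′) (h1 j)
        simp only [map_sum, map_zero, Derivation.leibniz, smul_eq_mul, ← jet_succ,
          Finset.sum_add_distrib] at h
        rw [h1, zero_add, Finset.sum_insert hi₀, hb0, Derivation.map_one_eq_zero, mul_zero,
          zero_add] at h
        rw [← h]
        exact Finset.sum_congr rfl fun i _ => mul_comm _ _
      have h3 : ∀ i ∈ s, (b i)′ = 0 := by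
        refine ih _ (funext fun j => ?_)
        simpa only [Finset.sum_apply, Pi.smul_apply, smul_eq_mul, Pi.zero_apply] using h2 j
      have h4 : ∀ i ∈ insert i₀ s, ∃ c : C, algebraMap C F c = b i := by
        intro i hi
        rcases Finset.mem_insert.1 hi with rfl | hi
        · exact ⟨1, by rw [hb0, map_one]⟩
        · exact hF _ (h3 i hi)
      choose! c hc using h4
      have h5 : ∑ i ∈ insert i₀ s, c i • f i = 0 := by
        rw [← h1 0]
        exact Finset.sum_congr rfl fun i hi => by rw [Algebra.smul_def, hc i hi]; rfl
      have h6 := linearIndependent_iff'.1 hf _ _ h5 i₀ (Finset.mem_insert_self _ _)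
      have h7 := hc i₀ (Finset.mem_insert_self _ _)
      rw [h6, map_zero, hb0] at h7
      exact zero_ne_one h7
    rw [Finset.sum_insert hi₀, key, zero_smul, zero_add] at ha
    intro i hi
    rcases Finset.mem_insert.1 hi with rfl | hi
    · exact key
    · exact ih a ha i hi

variable [Algebra K F] [DifferentialAlgebra K F]

/-- An operator of order `n` has at most `n` solutions that are linearly independent over the
constants. -/
theorem card_le_order (hF : ∀ y : F, y′ = 0 → ∃ c : C, algebraMap C F c = y)
    {R : DiffOp K} (hR : R ≠ 0) {ι : Type*} [Fintype ι] {f : ι → F} (hf : LinearIndependent C f)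
    (hs : ∀ i, R • f i = 0) : Fintype.card ι ≤ R.order := by
  have h1 := linearIndependent_jet hF hf
  let π : (ℕ → F) →ₗ[F] (Fin R.order → F) := LinearMap.funLeft F F Fin.val
  -- A vector in the $F$-span of the jets is determined by its first `R.order` entries, so
  -- independence survives in a space of that dimension.
  have h2 : Disjoint (Submodule.span F (Set.range fun i => jet (f i))) (LinearMap.ker π) := by
    rw [Submodule.disjoint_def]
    intro w hw hπ
    -- Each multiple of `R` gives a recurrence that is $F$-linear in the jet, so it passes from the
    -- jets of solutions to their $F$-span.
    have h3 : ∀ Q : DiffOp K, ∑ i ∈ Finset.range ((Q * R).order + 1),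
        algebraMap K F ((Q * R).coeff i) * w i = 0 := by
      intro Q
      clear hπ
      induction hw using Submodule.span_induction with
      | mem x hx =>
        obtain ⟨i, rfl⟩ := hx
        exact (smul_eq_sum (Q * R) (f i)).symm.trans (by rw [mul_smul, hs, smul_zero])
      | zero => simp
      | add x y _ _ hx hy =>
        simp only [Pi.add_apply, mul_add, Finset.sum_add_distrib, hx, hy, add_zero]
      | smul a x _ hx =>
        simp only [Pi.smul_apply, smul_eq_mul, mul_left_comm _ a, ← Finset.mul_sum, hx, mul_zero]
    funext N
    induction N using Nat.strong_induction_on with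
    | _ N ih =>
      rcases lt_or_ge N R.order with hN | hN
      · exact congrFun hπ ⟨N, hN⟩
      · obtain ⟨k, rfl⟩ := Nat.exists_eq_add_of_le hN
        -- A multiple of `R` of order exactly $N$ expresses entry $N$ through the earlier entries,
        -- which are zero.
        obtain ⟨Q, h0, h4⟩ := exists_degree_eq_mem_span hR k
        have h5 := h3 Q
        rw [Finset.sum_range_succ, Finset.sum_eq_zero, zero_add, mul_eq_zero,
          map_eq_zero] at h5
        · rcases h5 with h5 | h5
          · exact absurd h5 (Polynomial.leadingCoeff_ne_zero.2 h0)
          · rwa [h4] at h5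
        · intro i hi
          rw [Finset.mem_range, h4] at hi
          rw [ih i hi, Pi.zero_apply, mul_zero]
  have h3 := (h1.map h2).fintype_card_le_finrank
  simpa using h3

end jets
end DiffOp

/-! ### Constants in algebraic extensions -/

theorem exists_algebraMap_eq_of_isAlgebraic {C E : Type*} [Field C] [IsAlgClosed C] [Field E]
    [Algebra C E] {y : E} (hy : IsAlgebraic C y) : ∃ c : C, algebraMap C E c = y := by
  have h := IntermediateField.eq_bot_of_isAlgClosed_of_isAlgebraic (algebraicClosure C E)
  have h1 : y ∈ algebraicClosure C E := mem_algebraicClosure_iff.2 hy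
  rw [h] at h1
  exact IntermediateField.mem_bot.1 h1

/-- A minimal polynomial over `K` with coefficients in `C` makes `y` algebraic over `C`, which is
algebraically closed. -/
theorem exists_algebraMap_eq_of_minpoly_mem_lifts {C K E : Type*} [Field C] [IsAlgClosed C]
    [Field K] [Field E] [Algebra C K] [Algebra C E] [Algebra K E] [IsScalarTower C K E] {y : E}
    (hy : IsIntegral K y) (h : minpoly K y ∈ Polynomial.lifts (algebraMap C K)) :
    ∃ c : C, algebraMap C E c = y := by
  obtain ⟨q, hq, -, hm⟩ := Polynomial.lifts_and_natDegree_eq_and_monic h (minpoly.monic hy)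
  refine exists_algebraMap_eq_of_isAlgebraic ⟨q, hm.ne_zero, ?_⟩
  rw [← Polynomial.aeval_map_algebraMap K, hq, minpoly.aeval]

/-- In an algebraic extension `E` of a differential field `K`
whose constants form an algebraically closed field `C`, every constant is in `C`. -/
theorem exists_algebraMap_eq_of_deriv_eq_zero {C K E : Type*} [Field C] [IsAlgClosed C] [Field K]
    [Field E] [Differential K] [Differential E] [Algebra C K] [Algebra C E] [Algebra K E]
    [IsScalarTower C K E] [DifferentialAlgebra K E]
    (hK : ∀ y : K, y′ = 0 → ∃ c : C, algebraMap C K c = y) {y : E} (hy : IsAlgebraic K y)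
    (hd : y′ = 0) : ∃ c : C, algebraMap C E c = y := by
  have hi := hy.isIntegral
  have h1 : Polynomial.aeval y (Differential.mapCoeffs (minpoly K y)) = 0 := by
    have h := Differential.deriv_aeval_eq y (minpoly K y)
    rw [minpoly.aeval, map_zero, hd, mul_zero, add_zero] at h
    exact h.symm
  -- Differentiating the coefficients kills the leading $1$, so a nonzero result would be an
  -- annihilator of `y` of degree smaller than that of `minpoly K y`.
  have h2 : Differential.mapCoeffs (minpoly K y) = 0 := by
    by_contra h0
    refine (minpoly.degree_le_of_ne_zero K y h0 h1).not_gt ?_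
    rw [Polynomial.degree_eq_natDegree (minpoly.ne_zero hi), Polynomial.degree_lt_iff_coeff_zero]
    intro m hm
    rw [Differential.coeff_mapCoeffs]
    rcases hm.eq_or_lt with rfl | hm
    · rw [(minpoly.monic hi).coeff_natDegree, Derivation.map_one_eq_zero]
    · rw [Polynomial.coeff_eq_zero_of_natDegree_lt hm, map_zero]
  refine exists_algebraMap_eq_of_minpoly_mem_lifts hi ?_
  rw [Polynomial.lifts_iff_coeff_lifts]
  intro n
  refine hK _ ?_
  rw [← Differential.coeff_mapCoeffs, h2, Polynomial.coeff_zero]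

/-! ### Integral Puiseux series and rational functions without poles -/

namespace PuiseuxAt

variable {C : Type u} [Field C]

/-- The integral Puiseux series. -/
def integers (ξ : OnePoint C) : Subalgebra C (PuiseuxAt C ξ) where
  carrier := {f | f.IsIntegral}
  mul_mem' {f g} hf hg := by
    change (f.toHahn * g.toHahn) = 0 ∨ 0 ≤ (f.toHahn * g.toHahn).order
    rcases eq_or_ne f.toHahn 0 with h | h
    · simp [h]
    rcases eq_or_ne g.toHahn 0 with h' | h'
    · simp [h']
    rw [HahnSeries.order_mul h h']
    exact Or.inr (add_nonneg (hf.resolve_left h) (hg.resolve_left h'))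
  add_mem' {f g} hf hg := by
    change (f.toHahn + g.toHahn) = 0 ∨ 0 ≤ (f.toHahn + g.toHahn).order
    rcases eq_or_ne f.toHahn 0 with h | h
    · rw [h, zero_add]; exact hg
    rcases eq_or_ne g.toHahn 0 with h' | h'
    · rw [h', add_zero]; exact hf
    refine or_iff_not_imp_left.2 fun h0 => ?_
    exact (le_min (hf.resolve_left h) (hg.resolve_left h')).trans
      (HahnSeries.min_order_le_order_add h0)
  algebraMap_mem' c := by
    change (HahnSeries.C c : HahnSeries ℚ C) = 0 ∨ 0 ≤ (HahnSeries.C c : HahnSeries ℚ C).order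
    rw [HahnSeries.order_C]
    exact Or.inr le_rfl

theorem aeval_mem_integers {ξ : OnePoint C} {f : PuiseuxAt C ξ} (hf : f ∈ integers ξ) (p : C[X]) :
    Polynomial.aeval f p ∈ integers ξ := by
  have h := (integers ξ).aeval_coe ⟨f, hf⟩ p
  exact h ▸ (Polynomial.aeval (⟨f, hf⟩ : integers ξ) p).2

/-- The monomial `c t ^ n`. -/
noncomputable def mono (ξ : OnePoint C) (n : ℤ) (c : C) : PuiseuxAt C ξ := Puiseux.mono n c

theorem mono_mem_integers (ξ : OnePoint C) {n : ℤ} (hn : 0 ≤ n) (c : C) :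
    mono ξ n c ∈ integers ξ := by
  change (HahnSeries.single (n : ℚ) c) = 0 ∨ 0 ≤ (HahnSeries.single (n : ℚ) c).order
  rcases eq_or_ne c 0 with rfl | hc
  · simp
  · rw [HahnSeries.order_single hc]
    exact Or.inr (by exact_mod_cast hn)

theorem mono_neg_one_notMem_integers (ξ : OnePoint C) :
    mono ξ (-1) 1 ∉ integers ξ := by
  change ¬ ((HahnSeries.single ((-1 : ℤ) : ℚ) (1 : C)) = 0 ∨
    0 ≤ (HahnSeries.single ((-1 : ℤ) : ℚ) (1 : C)).order)
  rw [HahnSeries.order_single one_ne_zero]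
  simp

theorem mono_mul_mono_neg (ξ : OnePoint C) :
    mono ξ 1 1 * mono ξ (-1) 1 = 1 := by
  refine (Puiseux.mono_mul_mono _ _ _ _).trans ?_
  rw [mul_one, add_neg_cancel, ← Puiseux.const_eq_mono, map_one]
  rfl

theorem x_coe_mem_integers (ξ : C) : x (ξ : OnePoint C) ∈ integers (ξ : OnePoint C) :=
  add_mem ((integers (ξ : OnePoint C)).algebraMap_mem ξ) (mono_mem_integers _ zero_le_one 1)

/-- Write $p = p_1x + p(0)$. Then $p_1x$ is integral at infinity, and so is $p_1$, on multiplying by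
$t=x^{-1}$. By induction $p_1$ is a constant; for nonconstant $p$ it is nonzero, which would make
$x=t^{-1}$ integral. -/
theorem natDegree_eq_zero_of_aeval_mem_integers (p : C[X])
    (hp : Polynomial.aeval (x (OnePoint.infty : OnePoint C)) p ∈ integers OnePoint.infty) :
    p.natDegree = 0 := by
  induction h : p.natDegree using Nat.strong_induction_on generalizing p with
  | _ n ih =>
    subst h
    by_contra hn
    have hx : mono OnePoint.infty 1 (1 : C) * x (OnePoint.infty : OnePoint C) = 1 :=
      mono_mul_mono_neg _
    have h1 : Polynomial.aeval (x (OnePoint.infty : OnePoint C)) (p.divX) * x OnePoint.infty ∈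
        integers OnePoint.infty := by
      have h2 := congrArg (Polynomial.aeval (x (OnePoint.infty : OnePoint C))) p.divX_mul_X_add
      rw [map_add, map_mul, Polynomial.aeval_X, Polynomial.aeval_C] at h2
      rw [eq_sub_of_add_eq h2]
      exact sub_mem hp ((integers _).algebraMap_mem _)
    have h3 : Polynomial.aeval (x (OnePoint.infty : OnePoint C)) p.divX ∈
        integers OnePoint.infty := by
      have h4 := mul_mem h1 (mono_mem_integers OnePoint.infty zero_le_one (1 : C))
      rwa [mul_assoc, mul_comm (x _), hx, mul_one] at h4
    have h5 := Polynomial.natDegree_divX_eq_natDegree_tsub_one (p := p)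
    have h6 := ih _ (by omega) p.divX h3 rfl
    rw [Polynomial.eq_C_of_natDegree_eq_zero h6, Polynomial.aeval_C] at h1
    have h7 : p.divX.coeff 0 ≠ 0 := by
      rw [Polynomial.coeff_divX, zero_add, show 1 = p.natDegree by omega]
      exact Polynomial.leadingCoeff_ne_zero.2 (by rintro rfl; simp at hn)
    have h8 := mul_mem ((integers OnePoint.infty).algebraMap_mem (p.divX.coeff 0)⁻¹) h1
    rw [← mul_assoc, ← map_mul, inv_mul_cancel₀ h7, map_one, one_mul] at h8
    exact mono_neg_one_notMem_integers _ h8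

variable [CharZero C]

/-- A rational function without poles on the projective line is constant. -/
theorem exists_algebraMap_eq_of_mem_integers [IsAlgClosed C] (f : RatFunc C)
    (hf : ∀ ξ : OnePoint C, algebraMap (RatFunc C) (PuiseuxAt C ξ) f ∈ integers ξ) :
    ∃ c : C, algebraMap C (RatFunc C) c = f := by
  have hd : f.denom.natDegree = 0 := by
    by_contra h0
    obtain ⟨ξ, hξ⟩ := IsAlgClosed.exists_root f.denom
      (fun h => h0 (Polynomial.natDegree_eq_of_degree_eq_some h))
    obtain ⟨u, hu⟩ := Polynomial.dvd_iff_isRoot.2 hξ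
    obtain ⟨a, b, hab⟩ := f.isCoprime_num_denom
    have hq : Polynomial.aeval (x (ξ : OnePoint C)) f.denom ≠ 0 := fun h =>
      f.denom_ne_zero (aeval_x_injective _ (by rw [h, map_zero]))
    have h1 : algebraMap (RatFunc C) (PuiseuxAt C (ξ : OnePoint C)) f =
        Polynomial.aeval (x (ξ : OnePoint C)) f.num /
          Polynomial.aeval (x (ξ : OnePoint C)) f.denom := by
      conv_lhs => rw [← f.num_div_denom]
      exact expand_div _ _ _
    have hP := fun p => aeval_mem_integers (x_coe_mem_integers ξ) p
    -- With the Bézout relation $a\,p+b\,q=1$ for $f=p/q$, this element $af+b$ is $1/q$. Multiplying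
    -- by $u=q/(x-\xi)$ then makes $t^{-1}$ integral at the root $\xi$ of $q$, a contradiction.
    have h2 := add_mem (mul_mem (hP a) (hf ξ)) (hP b)
    have h3 := congrArg (Polynomial.aeval (x (ξ : OnePoint C))) hab
    rw [map_add, map_mul, map_mul, map_one] at h3
    have h4 : Polynomial.aeval (x (ξ : OnePoint C)) a *
        algebraMap (RatFunc C) (PuiseuxAt C (ξ : OnePoint C)) f +
        Polynomial.aeval (x (ξ : OnePoint C)) b =
          (Polynomial.aeval (x (ξ : OnePoint C)) f.denom)⁻¹ := by
      rw [h1]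
      field_simp
      rwa [mul_comm (Polynomial.aeval _ b)] at h3
    rw [h4] at h2
    have h5 := mul_mem h2 (hP u)
    have h6 : Polynomial.aeval (x (ξ : OnePoint C)) f.denom =
        mono (ξ : OnePoint C) 1 1 *
          Polynomial.aeval (x (ξ : OnePoint C)) u := by
      rw [hu, map_mul, map_sub, Polynomial.aeval_X, Polynomial.aeval_C]
      congr 1
      exact add_sub_cancel_left (Puiseux.const ξ) (Puiseux.mono 1 1)
    have h7 : (Polynomial.aeval (x (ξ : OnePoint C)) f.denom)⁻¹ *
        Polynomial.aeval (x (ξ : OnePoint C)) u = mono (ξ : OnePoint C) (-1) 1 := by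
      rw [inv_mul_eq_iff_eq_mul₀ hq, h6, mul_right_comm, mono_mul_mono_neg, one_mul]
    rw [h7] at h5
    exact mono_neg_one_notMem_integers _ h5
  have h1 : f.denom = 1 := Polynomial.eq_one_of_monic_natDegree_zero f.monic_denom hd
  have h2 : algebraMap C[X] (RatFunc C) f.num = f := by
    conv_rhs => rw [← f.num_div_denom, h1, map_one, div_one]
  have h3 : f.num.natDegree = 0 := by
    refine natDegree_eq_zero_of_aeval_mem_integers _ ?_
    have h := hf OnePoint.infty
    rw [← h2] at h
    exact expand_poly OnePoint.infty f.num ▸ h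
  refine ⟨f.num.coeff 0, ?_⟩
  conv_rhs => rw [← h2, Polynomial.eq_C_of_natDegree_eq_zero h3]
  rfl

/-- Up to the nonzero factor `dlogParam ξ` the derivation is $t\,d/dt$, which multiplies the
coefficient of $t^s$ by $s$; in characteristic zero only the exponent $0$ survives. -/
theorem exists_algebraMap_eq_of_deriv_eq_zero {ξ : OnePoint C} (f : PuiseuxAt C ξ) (hf : f′ = 0) :
    ∃ c : C, algebraMap C (PuiseuxAt C ξ) c = f := by
  have h0 : dlogParam ξ ≠ 0 := fun h => by
    have h1 := ddx_x ξ
    rw [ddx_apply, h, zero_mul] at h1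
    exact zero_ne_one h1
  have h1 : tddt ξ f = 0 :=
    (mul_eq_zero.1 (show dlogParam ξ * tddt ξ f = 0 from hf)).resolve_left h0
  refine ⟨f.toHahn.coeff 0, Subtype.ext (HahnSeries.ext (funext fun s => ?_))⟩
  change (HahnSeries.C (f.toHahn.coeff 0) : HahnSeries ℚ C).coeff s = f.toHahn.coeff s
  have h2 : (s : C) * f.toHahn.coeff s = 0 :=
    congrArg (fun g : PuiseuxAt C ξ => g.toHahn.coeff s) h1
  rcases eq_or_ne s 0 with rfl | hs
  · simp
  · rw [(mul_eq_zero.1 h2).resolve_left (by exact_mod_cast hs)]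
    simp [hs]

end PuiseuxAt

theorem RatFunc.exists_algebraMap_eq_of_deriv_eq_zero {C : Type u} [Field C] [CharZero C]
    (f : RatFunc C) (hf : f′ = 0) : ∃ c : C, algebraMap C (RatFunc C) c = f := by
  have h := deriv_algebraMap (B := PuiseuxAt C OnePoint.infty) f
  rw [hf, map_zero] at h
  obtain ⟨c, hc⟩ := PuiseuxAt.exists_algebraMap_eq_of_deriv_eq_zero _ h
  refine ⟨c, (algebraMap (RatFunc C) (PuiseuxAt C OnePoint.infty)).injective ?_⟩
  rw [← hc, ← IsScalarTower.algebraMap_apply]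

/-! ### Algebraic solutions and completely integral classes -/

namespace DiffOp

section

variable {K E F : Type*} [Field K] [Differential K] [Field E] [Algebra K E] [Differential E]
  [DifferentialAlgebra K E] [Field F] [Algebra K F] [Differential F] [DifferentialAlgebra K F]

theorem D_smul (y : E) : (D : DiffOp K) • y = y′ := by
  change evalAt (derivEnd E) (Polynomial.X : K[X]) y = _
  rw [evalAt, Polynomial.eval₂_X]
  rfl

theorem map_smul_of_map_deriv (σ : E →ₐ[K] F) (hσ : ∀ y, σ (y′) = (σ y)′) (P : DiffOp K) (y : E) :
    σ (P • y) = P • σ y := by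
  have h : ∀ i, σ ((fun z : E => z′)^[i] y) = (fun z : F => z′)^[i] (σ y) := fun i =>
    Function.Semiconj.iterate_right (f := σ) hσ i y
  simp only [smul_eq_sum, map_sum, map_mul, AlgHom.commutes, h]

end

variable {C : Type u} [Field C]

theorem mem_solutionSpace {L : DiffOp (RatFunc C)} {F : Type*} [Field F] [Algebra (RatFunc C) F]
    [Algebra C F] [IsScalarTower C (RatFunc C) F] [Differential F]
    [DifferentialAlgebra (RatFunc C) F] {y : F} : y ∈ L.solutionSpace F ↔ L • y = 0 := Iff.rfl

variable [CharZero C] {L : DiffOp (RatFunc C)}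

/-- The zero operator has `order` $0$ by convention, yet it kills $1$. -/
theorem HasPuiseuxBasisAt.ne_zero {ξ : OnePoint C} (h : L.HasPuiseuxBasisAt ξ) : L ≠ 0 := by
  rintro rfl
  obtain ⟨b⟩ := h
  have : IsEmpty (Fin (0 : DiffOp (RatFunc C)).order) := by
    rw [show (0 : DiffOp (RatFunc C)).order = 0 from Polynomial.natDegree_zero]
    infer_instance
  have h1 : (⟨1, zero_smul _ _⟩ : (0 : DiffOp (RatFunc C)).solutionSpace (PuiseuxAt C ξ)) = 0 :=
    b.repr.injective (Subsingleton.elim _ _)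
  exact one_ne_zero (congrArg Subtype.val h1)

/-- Solutions in an algebraic extension of the field of Puiseux series are Puiseux series. -/
theorem HasPuiseuxBasisAt.exists_algebraMap_eq [IsAlgClosed C] {ξ : OnePoint C}
    (h : L.HasPuiseuxBasisAt ξ)
    {F : Type*} [Field F] [Algebra (PuiseuxAt C ξ) F] [Algebra C F]
    [IsScalarTower C (PuiseuxAt C ξ) F] [Algebra (RatFunc C) F] [Differential F]
    [IsScalarTower (RatFunc C) (PuiseuxAt C ξ) F]
    [DifferentialAlgebra (RatFunc C) F] [DifferentialAlgebra (PuiseuxAt C ξ) F]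
    [Algebra.IsAlgebraic (PuiseuxAt C ξ) F] {y : F} (hy : L • y = 0) :
    ∃ f : PuiseuxAt C ξ, L • f = 0 ∧ algebraMap (PuiseuxAt C ξ) F f = y := by
  obtain ⟨b⟩ := id h
  let φ : PuiseuxAt C ξ →ₐ[C] F := IsScalarTower.toAlgHom C (PuiseuxAt C ξ) F
  let ψ : PuiseuxAt C ξ →ₐ[RatFunc C] F := IsScalarTower.toAlgHom (RatFunc C) (PuiseuxAt C ξ) F
  let v : Fin L.order → F := fun i => φ (b i : PuiseuxAt C ξ)
  have hF : ∀ z : F, z′ = 0 → ∃ c : C, algebraMap C F c = z := fun z hz =>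
    exists_algebraMap_eq_of_deriv_eq_zero (K := PuiseuxAt C ξ)
      PuiseuxAt.exists_algebraMap_eq_of_deriv_eq_zero (Algebra.IsAlgebraic.isAlgebraic z) hz
  have hv : LinearIndependent C v := by
    have h1 : LinearIndependent C fun i => (b i : PuiseuxAt C ξ) :=
      b.linearIndependent.map' (L.solutionSpace (PuiseuxAt C ξ)).subtype (Submodule.ker_subtype _)
    exact h1.map' φ.toLinearMap (LinearMap.ker_eq_bot.2 φ.injective)
  have hs : ∀ i, L • v i = 0 := fun i => by
    have h1 := map_smul_of_map_deriv ψ (fun z => (deriv_algebraMap z).symm) L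
      (b i : PuiseuxAt C ξ)
    rw [mem_solutionSpace.1 (b i).2, map_zero] at h1
    exact h1.symm
  have hspan : y ∈ Submodule.span C (Set.range v) := by
    by_contra hn
    -- Together with the Puiseux basis, `y` would give `L.order + 1` independent solutions over the
    -- constants of `F`, which are still `C`.
    have h1 := linearIndependent_option'.2 ⟨hv, hn⟩
    have h2 := card_le_order hF h.ne_zero h1 (by rintro (_ | i); exacts [hy, hs i])
    simp at h2
  have h1 : Submodule.span C (Set.range v) ≤
      (L.solutionSpace (PuiseuxAt C ξ)).map φ.toLinearMap := by
    rw [Submodule.span_le]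
    rintro _ ⟨i, rfl⟩
    exact ⟨b i, (b i).2, rfl⟩
  exact h1 hspan

/-- The local form of the argument: each conjugate $\sigma(P\cdot y)$ is an integral Puiseux series.
Since `Ω` carries no derivation, the image of `σ` is placed in a finite extension `F` of the Puiseux
field, to which the derivation extends. -/
theorem exists_mem_integers_of_algHom [IsAlgClosed C] {ξ : OnePoint C} (h : L.HasPuiseuxBasisAt ξ)
    {P : DiffOp (RatFunc C)} (hP : ∀ f : PuiseuxAt C ξ, L • f = 0 → P • f ∈ PuiseuxAt.integers ξ)
    {E : Type*} [Field E] [Algebra (RatFunc C) E] [Differential E]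
    [DifferentialAlgebra (RatFunc C) E] [FiniteDimensional (RatFunc C) E]
    {Ω : Type*} [Field Ω] [Algebra (PuiseuxAt C ξ) Ω] [Algebra (RatFunc C) Ω]
    [IsScalarTower (RatFunc C) (PuiseuxAt C ξ) Ω] [Algebra.IsAlgebraic (PuiseuxAt C ξ) Ω]
    (σ : E →ₐ[RatFunc C] Ω) {y : E} (hy : L • y = 0) :
    ∃ g ∈ PuiseuxAt.integers ξ, algebraMap (PuiseuxAt C ξ) Ω g = σ (P • y) := by
  have : CharZero (PuiseuxAt C ξ) := charZero_of_injective_algebraMap (algebraMap C _).injective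
  let b := Module.finBasis (RatFunc C) E
  let F : IntermediateField (PuiseuxAt C ξ) Ω :=
    IntermediateField.adjoin (PuiseuxAt C ξ) (Set.range (σ ∘ b))
  have : FiniteDimensional (PuiseuxAt C ξ) F :=
    IntermediateField.finiteDimensional_adjoin fun x _ => Algebra.IsIntegral.isIntegral x
  have : DifferentialAlgebra (RatFunc C) F := ⟨fun a => by
    rw [IsScalarTower.algebraMap_apply (RatFunc C) (PuiseuxAt C ξ) F, deriv_algebraMap,
      deriv_algebraMap, ← IsScalarTower.algebraMap_apply]⟩
  let _ : Algebra C F := ((algebraMap (PuiseuxAt C ξ) F).comp (algebraMap C _)).toAlgebra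
  have : IsScalarTower C (PuiseuxAt C ξ) F := IsScalarTower.of_algebraMap_eq fun _ => rfl
  have hF : ∀ z : E, σ z ∈ F := by
    intro z
    rw [← b.sum_repr z, map_sum]
    refine sum_mem fun i _ => ?_
    rw [map_smul, Algebra.smul_def, IsScalarTower.algebraMap_apply (RatFunc C) (PuiseuxAt C ξ) Ω]
    exact mul_mem (F.algebraMap_mem _) (IntermediateField.subset_adjoin _ _ ⟨i, rfl⟩)
  let τ : E →ₐ[RatFunc C] F :=
    { (σ : E →+* Ω).codRestrict F hF with
      commutes' := fun a => Subtype.ext (σ.commutes a) }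
  -- Nothing was assumed about `σ` and derivations; compatibility is automatic, as a derivation
  -- extends uniquely to algebraic extensions in characteristic zero.
  have hτ := map_smul_of_map_deriv τ (Differential.algHom_deriv' τ τ.injective)
  have h1 : L • τ y = 0 := by rw [← hτ, hy, map_zero]
  obtain ⟨f, hf, hfy⟩ := h.exists_algebraMap_eq h1
  refine ⟨P • f, hP f hf, ?_⟩
  have h2 := map_smul_of_map_deriv (IsScalarTower.toAlgHom (RatFunc C) (PuiseuxAt C ξ) F)
    (fun z => (deriv_algebraMap z).symm) P f
  have h3 : algebraMap (PuiseuxAt C ξ) F (P • f) = τ (P • y) := by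
    rw [hτ, ← hfy]; exact h2
  exact congrArg (algebraMap F Ω) h3

/-- If `P` maps the Puiseux series solutions of `L` to integral ones, then it maps the algebraic
solutions to constants. -/
theorem deriv_smul_eq_zero_of_finiteDimensional [IsAlgClosed C]
    (hL : ∀ ξ : OnePoint C, L.HasPuiseuxBasisAt ξ)
    {P : DiffOp (RatFunc C)}
    (hP : ∀ (ξ : OnePoint C) (f : PuiseuxAt C ξ), L • f = 0 → P • f ∈ PuiseuxAt.integers ξ)
    {E : Type*} [Field E] [Algebra (RatFunc C) E] [Differential E]
    [DifferentialAlgebra (RatFunc C) E] [FiniteDimensional (RatFunc C) E]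
    {y : E} (hy : L • y = 0) : (P • y)′ = 0 := by
  let _ : Algebra C E := ((algebraMap (RatFunc C) E).comp (algebraMap C _)).toAlgebra
  have : IsScalarTower C (RatFunc C) E := IsScalarTower.of_algebraMap_eq fun _ => rfl
  have hi : IsIntegral (RatFunc C) (P • y) := Algebra.IsIntegral.isIntegral _
  obtain ⟨c, hc⟩ : ∃ c : C, algebraMap C E c = P • y := by
    refine exists_algebraMap_eq_of_minpoly_mem_lifts hi ?_
    rw [Polynomial.lifts_iff_coeff_lifts]
    intro n
    refine PuiseuxAt.exists_algebraMap_eq_of_mem_integers _ fun ξ => ?_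
    let Ω := AlgebraicClosure (PuiseuxAt C ξ)
    -- The polynomial is monic and splits in `Ω`, so its coefficients are integral once its roots
    -- are.
    have h1 : (minpoly (RatFunc C) (P • y)).map (algebraMap (RatFunc C) Ω) ∈
        Polynomial.lifts ((algebraMap (PuiseuxAt C ξ) Ω).comp
          (algebraMap (PuiseuxAt.integers ξ) (PuiseuxAt C ξ))) := by
      refine (IsAlgClosed.splits _).mem_lift_of_roots_mem_range ((minpoly.monic hi).map _) _ ?_
      intro z hz
      have h2 : z ∈ (minpoly (RatFunc C) (P • y)).rootSet Ω := by
        rw [Polynomial.mem_roots_map (minpoly.ne_zero hi)] at hz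
        exact Polynomial.mem_rootSet.2 ⟨minpoly.ne_zero hi, hz⟩
      -- Every root is the image of `P • y` under some embedding `σ` of `E` into `Ω`.
      rw [← Algebra.IsAlgebraic.range_eval_eq_rootSet_minpoly] at h2
      obtain ⟨σ, hσ⟩ := h2
      obtain ⟨g, hg, h3⟩ := exists_mem_integers_of_algHom (hL ξ) (hP ξ) σ hy
      exact ⟨⟨g, hg⟩, h3.trans hσ⟩
    rw [Polynomial.lifts_iff_coeff_lifts] at h1
    obtain ⟨g, hg⟩ := h1 n
    rw [Polynomial.coeff_map, IsScalarTower.algebraMap_apply (RatFunc C) (PuiseuxAt C ξ) Ω] at hg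
    exact (algebraMap (PuiseuxAt C ξ) Ω).injective hg ▸ g.2
  rw [← hc, IsScalarTower.algebraMap_apply C (RatFunc C) E, deriv_algebraMap,
    RatFunc.deriv_algebraMap_const, map_zero]

/-- Reduces to the finite extension generated by `y`; this allows `E` to be a Puiseux field, which
is not finite over $C(x)$. -/
theorem deriv_smul_eq_zero_of_isAlgebraic [IsAlgClosed C]
    (hL : ∀ ξ : OnePoint C, L.HasPuiseuxBasisAt ξ)
    {P : DiffOp (RatFunc C)}
    (hP : ∀ (ξ : OnePoint C) (f : PuiseuxAt C ξ), L • f = 0 → P • f ∈ PuiseuxAt.integers ξ)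
    {E : Type*} [Field E] [Algebra (RatFunc C) E] [Differential E]
    [DifferentialAlgebra (RatFunc C) E] {y : E} (ha : IsAlgebraic (RatFunc C) y)
    (hy : L • y = 0) : (P • y)′ = 0 := by
  have : CharZero (RatFunc C) := charZero_of_injective_algebraMap (algebraMap C _).injective
  let F := IntermediateField.adjoin (RatFunc C) {y}
  have : FiniteDimensional (RatFunc C) F := IntermediateField.adjoin.finiteDimensional ha.isIntegral
  let z : F := IntermediateField.AdjoinSimple.gen (RatFunc C) y
  have hF := map_smul_of_map_deriv F.val (fun w => (deriv_algebraMap (A := F) (B := E) w).symm)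
  have hz : L • z = 0 := F.val.injective ((hF L z).trans (hy.trans (map_zero F.val).symm))
  have h1 : (F.val (P • z))′ = F.val ((P • z)′) := deriv_algebraMap (A := F) (B := E) (P • z)
  rw [hF, deriv_smul_eq_zero_of_finiteDimensional hL hP hz, map_zero] at h1
  exact h1

/-- Every completely integral class is constant as soon as `L` has a full set of algebraic
solutions. -/
theorem QuotMod.IsCompletelyIntegral.isConstant [IsAlgClosed C]
    (hL : ∀ ξ : OnePoint C, L.HasPuiseuxBasisAt ξ)
    {m : L.QuotMod} (hm : m.IsCompletelyIntegral)
    {E : Type*} [Field E] [Algebra (RatFunc C) E] [Algebra C E] [IsScalarTower C (RatFunc C) E]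
    [Differential E] [DifferentialAlgebra (RatFunc C) E]
    (hE : ∀ z : E, z′ = 0 → ∃ c : C, algebraMap C E c = z)
    (b : Module.Basis (Fin L.order) C (L.solutionSpace E))
    (ha : ∀ f : E, L • f = 0 → IsAlgebraic (RatFunc C) f) : m.IsConstant := by
  obtain ⟨P, rfl⟩ := Submodule.Quotient.mk_surjective _ m
  have hL0 := (hL OnePoint.infty).ne_zero
  have h1 : ∀ f : E, L • f = 0 → (D * P) • f = 0 := fun f hf => by
    rw [mul_smul, D_smul]
    exact deriv_smul_eq_zero_of_isAlgebraic hL hm (ha f hf) hf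
  obtain ⟨Q, R, hQR, hR⟩ := exists_eq_mul_add hL0 (D * P)
  -- The remainder kills the `L.order` independent solutions killed by both `D * P` and `L`, but a
  -- nonzero one has smaller order.
  have hR0 : R = 0 := by
    by_contra hR0
    have h2 := card_le_order hE hR0 (b.linearIndependent.map' _ (Submodule.ker_subtype _))
      (fun i => by
        have h3 := h1 (b i) (b i).2
        rwa [hQR, add_smul, mul_smul, mem_solutionSpace.1 (b i).2, smul_zero, zero_add] at h3)
    rw [Fintype.card_fin] at h2
    exact (Polynomial.natDegree_lt_natDegree hR0 hR).not_ge h2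
  change Submodule.Quotient.mk (D * P) = (0 : L.QuotMod)
  rw [Submodule.Quotient.mk_eq_zero, hQR, hR0, add_zero]
  exact Ideal.mul_mem_left _ _ (Ideal.subset_span rfl)

end DiffOp

/-- Both claims are contrapositives of `QuotMod.IsCompletelyIntegral.isConstant`, taken with `E` a
finite extension of $C(x)$ and with `E` the Puiseux field at `ξ`. In each case the constants of `E`
are `C`. -/
theorem mainTheorem1 {C : Type*} [Field C] [IsAlgClosed C] [CharZero C]
    (L : DiffOp (RatFunc C))
    (hL : ∀ ξ : OnePoint C, L.HasPuiseuxBasisAt ξ)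
    (hP : ∃ m : L.QuotMod, m.IsPseudoconstant) :
    ¬ L.HasOnlyAlgebraicSolutions ∧
      ∀ ξ : OnePoint C, ∃ f : PuiseuxAt C ξ, L • f = 0 ∧ Transcendental (RatFunc C) f := by
  obtain ⟨m, hm, hn⟩ := hP
  constructor
  · rintro ⟨E, _, _, _, _, _, _, _, ⟨b⟩⟩
    refine hn (hm.isConstant hL (E := E) (fun z hz => ?_) b fun f _ => .of_finite _ f)
    exact exists_algebraMap_eq_of_deriv_eq_zero (K := RatFunc C)
      RatFunc.exists_algebraMap_eq_of_deriv_eq_zero (.of_finite _ z) hz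
  · intro ξ
    by_contra! h
    obtain ⟨b⟩ := hL ξ
    exact hn (hm.isConstant hL PuiseuxAt.exists_algebraMap_eq_of_deriv_eq_zero b fun f hf =>
      not_not.1 (h f hf))
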